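/- Theorem 9.5 (Malcev). Say that a group $G$ has property $\mathcal{R}$ if it has a subgroup $H$ such that the index $|G:H|$ is finite and the derived group $H'=[H,H]$ is nilpotent. (i) Let $V$ be a finite-dimensional vector space over a (commutative) field $\mathbb{K}$. Then every soluble subgroup $G$ of the group $GL(V)$ of all non-singular linear transformations of $V$ has property $\mathcal{R}$. (ii) Every polycyclic group $G$ has property $\mathcal{R}$; here $G$ is called polycyclic if it has a finite series of subgroups $G = G_0 \geq G_1 \geq \cdots \geq G_r = 1$ such that, for each $i = 1, \ldots, r$, $G_i$ is normal in $G_{i-1}$ and $G_{i-1}/G_i$ is cyclic. -/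

import Mathlib

/-- A group `G` is polycyclic if it has a series `G = s 0 ≥ s 1 ≥ … ≥ s r = 1` of subgroups such
that each `s (i + 1)` is normal in `s i` with cyclic factor group. -/
def IsPolycyclic (G : Type*) [Group G] : Prop :=
  ∃ (r : ℕ) (s : ℕ → Subgroup G), s 0 = ⊤ ∧ s r = ⊥ ∧
    ∀ i < r, s (i + 1) ≤ s i ∧
      ∃ _ : ((s (i + 1)).subgroupOf (s i)).Normal,
        IsCyclic (s i ⧸ (s (i + 1)).subgroupOf (s i))

/-- A group `G` has property `R` if it has a subgroup `H` of finite index whose derived group is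
nilpotent. -/
def HasPropertyR (G : Type*) [Group G] : Prop :=
  ∃ H : Subgroup G, H.FiniteIndex ∧ Group.IsNilpotent (commutator H)

/-! Both parts rest on one fact: a soluble linear group has a subgroup H of finite index whose
derived group H' acts unipotently, in the sense that all products of some fixed number of factors h
- 1 with h in H' vanish (`exists_finiteIndex_augSet_pow`). Unipotence of H' forces nilpotence
(`lowerCentralSeries_eq_bot_of_augSet_pow`), which gives (i); unlike triangularity, it also descends
from the algebraic closure. Over an algebraically closed field H plays the role of the Zariski
identity component: the algebra of matrix coefficients is noetherian, so it has finitely many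
idempotents, and their stabilizer has finite index and is connected. Lie–Kolchin then triangularizes
H, and the diagonal characters are trivial on H'.

For (ii), every subgroup of a polycyclic group is finitely generated, so G acts on the finitely
generated abelian group A/A' for each term A of the derived series. Tensoring with ℚ, and passing to
a subgroup that fixes the finite torsion part, makes some H' act unipotently there. Intersecting
these H over the finitely many factors lets the lower central series of H' descend through the
derived series to 1. -/

open scoped Pointwise commutatorElement Matrix


/-! ### Unipotent action implies nilpotence. -/

section Augmentation

/-- The set of all `ρ g - 1` with `g` in the subgroup `N`. -/
def augSet {G R : Type*} [Group G] [Ring R] (ρ : G →* R) (N : Subgroup G) : Set R :=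
  (fun g => ρ g - 1) '' (N : Set G)

variable {G R : Type*} [Group G] [Ring R]

theorem map_commutator_subtype (H : Subgroup G) : (commutator H).map H.subtype = ⁅H, H⁆ := by
  rw [commutator_def, Subgroup.map_commutator, ← MonoidHom.range_eq_map, Subgroup.range_subtype]

theorem isNilpotent_commutator_of_lowerCentralSeries {H : Subgroup G} {n : ℕ}
    (h : (⁅H, H⁆ : Subgroup G).lowerCentralSeries n = ⊥) : Group.IsNilpotent (commutator H) := by
  refine Subgroup.isNilpotent_of_lowerCentralSeries_eq_bot (n := n) ?_
  rw [← Subgroup.map_subtype_inj, Subgroup.map_bot, Subgroup.map_lowerCentralSeries,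
    map_commutator_subtype, h]

theorem augSet_comp_subtype (ρ : G →* R) (H : Subgroup G) :
    augSet (ρ.comp H.subtype) (commutator H) = augSet ρ ⁅H, H⁆ := by
  rw [← map_commutator_subtype]
  simp [augSet, Set.image_image]

theorem augSet_mono (ρ : G →* R) {M N : Subgroup G} (h : M ≤ N) : augSet ρ M ⊆ augSet ρ N :=
  Set.image_mono h

theorem image_augSet {R' : Type*} [Ring R'] (f : R →+* R') (ρ : G →* R) (N : Subgroup G) :
    f '' augSet ρ N = augSet ((f : R →* R').comp ρ) N := by
  simp [augSet, Set.image_image]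

/-- If `N` acts unipotently through `ρ`, then its lower central series dies in the image of `ρ`. -/
theorem lowerCentralSeries_eq_bot_of_augSet_pow {ρ : G →* R} (hρ : Function.Injective ρ)
    {N : Subgroup G} {m : ℕ} (h : augSet ρ N ^ m ⊆ {0}) : N.lowerCentralSeries m = ⊥ := by
  set I : Submodule ℤ R := Submodule.span ℤ (augSet ρ N) with hI
  have hmem : ∀ g ∈ N, ρ g - 1 ∈ I := fun g hg => Submodule.subset_span ⟨g, hg, rfl⟩
  have hII : I * I ≤ I := by
    rw [hI, Submodule.span_mul_span, Submodule.span_le]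
    rintro _ ⟨_, ⟨g, hg, rfl⟩, _, ⟨k, hk, rfl⟩, rfl⟩
    have : (ρ g - 1) * (ρ k - 1) = (ρ (g * k) - 1) - (ρ g - 1) - (ρ k - 1) := by
      rw [map_mul]; noncomm_ring
    simp only [SetLike.mem_coe, this]
    exact sub_mem (sub_mem (hmem _ (mul_mem hg hk)) (hmem _ hg)) (hmem _ hk)
  have hl : ∀ k, I * I ^ (k + 1) ≤ I ^ (k + 1) := by
    intro k
    rw [pow_succ', ← mul_assoc]
    exact mul_le_mul_left hII _
  have hr : ∀ k, I ^ (k + 1) * I ≤ I ^ (k + 1) := by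
    intro k
    rw [pow_succ, mul_assoc]
    exact mul_le_mul_right hII _
  have hlN : ∀ k, ∀ g ∈ N, ∀ x ∈ I ^ (k + 1), ρ g * x ∈ I ^ (k + 1) := by
    intro k g hg x hx
    have : ρ g * x = (ρ g - 1) * x + x := by noncomm_ring
    rw [this]
    exact add_mem (hl k (Submodule.mul_mem_mul (hmem g hg) hx)) hx
  have hrN : ∀ k, ∀ g ∈ N, ∀ x ∈ I ^ (k + 1), x * ρ g ∈ I ^ (k + 1) := by
    intro k g hg x hx
    have : x * ρ g = x * (ρ g - 1) + x := by noncomm_ring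
    rw [this]
    exact add_mem (hr k (Submodule.mul_mem_mul hx (hmem g hg))) hx
  -- Congruence subgroups modulo the powers of I, with [S k, N] ≤ S (k + 1). The exponent is k + 1
  -- because the lower central series starts with N itself at index 0.
  let S : ℕ → Subgroup G := fun k =>
    { carrier := {g | g ∈ N ∧ ρ g - 1 ∈ I ^ (k + 1)}
      one_mem' := ⟨one_mem _, by simp⟩
      mul_mem' := by
        rintro a b ⟨ha, ha'⟩ ⟨hb, hb'⟩
        refine ⟨mul_mem ha hb, ?_⟩
        have : ρ (a * b) - 1 = ρ a * (ρ b - 1) + (ρ a - 1) := by rw [map_mul]; noncomm_ring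
        rw [this]
        exact add_mem (hlN k a ha _ hb') ha'
      inv_mem' := by
        rintro a ⟨ha, ha'⟩
        refine ⟨inv_mem ha, ?_⟩
        have h1 : ρ a⁻¹ * ρ a = 1 := by rw [← map_mul, inv_mul_cancel, map_one]
        have : ρ a⁻¹ - 1 = -(ρ a⁻¹ * (ρ a - 1)) := by rw [mul_sub, h1]; noncomm_ring
        rw [this]
        exact neg_mem (hlN k _ (inv_mem ha) _ ha') }
  have key : ∀ k, N.lowerCentralSeries k ≤ S k := by
    intro k
    induction k with
    | zero => exact fun g hg => ⟨hg, by simpa using hmem g hg⟩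
    | succ k ih =>
      rw [Subgroup.lowerCentralSeries_succ, Subgroup.commutator_le]
      intro x hx y hy
      obtain ⟨hxN, hxI⟩ := ih hx
      refine ⟨?_, ?_⟩
      · rw [commutatorElement_def]
        exact mul_mem (mul_mem (mul_mem hxN hy) (inv_mem hxN)) (inv_mem hy)
      · have hx1 : ρ x * ρ x⁻¹ = 1 := by rw [← map_mul, mul_inv_cancel, map_one]
        have hy1 : ρ y * ρ y⁻¹ = 1 := by rw [← map_mul, mul_inv_cancel, map_one]
        have : ρ ⁅x, y⁆ - 1 =
            ((ρ x - 1) * (ρ y - 1) - (ρ y - 1) * (ρ x - 1)) * ρ x⁻¹ * ρ y⁻¹ := by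
          have e1 : (ρ x - 1) * (ρ y - 1) - (ρ y - 1) * (ρ x - 1) = ρ x * ρ y - ρ y * ρ x := by
            noncomm_ring
          rw [e1, commutatorElement_def, map_mul, map_mul, map_mul, sub_mul, sub_mul,
            mul_assoc (ρ y), hx1, mul_one, hy1]
        rw [this]
        refine hrN _ _ (inv_mem hy) _ (hrN _ _ (inv_mem hxN) _ (sub_mem ?_ ?_))
        · rw [pow_succ]
          exact Submodule.mul_mem_mul hxI (hmem y hy)
        · rw [pow_succ']
          exact Submodule.mul_mem_mul (hmem y hy) hxI
  have hbot : I ^ m = ⊥ := by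
    rw [hI, Submodule.span_pow, Submodule.span_eq_bot]
    exact fun x hx => h hx
  rw [eq_bot_iff]
  intro g hg
  have h1 := (key m hg).2
  rw [pow_succ, hbot, Submodule.bot_mul, Submodule.mem_bot, sub_eq_zero] at h1
  exact hρ (h1.trans (map_one ρ).symm)

end Augmentation

/-! ### Connectedness without a topology. -/

section Connected

variable {G K : Type*} [Group G]

/-- A family of functions on a group that is stable under inversion, translations and the
maps `x ↦ x g x⁻¹`. -/
structure IsTranslationStable (A : Set (G → K)) : Prop where
  inv : ∀ a ∈ A, (fun x => a x⁻¹) ∈ A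
  left : ∀ a ∈ A, ∀ g, (fun x => a (g * x)) ∈ A
  right : ∀ a ∈ A, ∀ g, (fun x => a (x * g)) ∈ A
  conj : ∀ a ∈ A, ∀ g, (fun x => a (x * g * x⁻¹)) ∈ A

/-- A subgroup is connected for a family `A` of functions if a function of `A` that takes only
finitely many values on the subgroup is constant on it. -/
def IsConnectedFor (A : Set (G → K)) (D : Subgroup G) : Prop :=
  ∀ a ∈ A, (a '' (D : Set G)).Finite → ∀ x ∈ D, a x = a 1

/-- For fixed y in D' and g in D, the function x ↦ a (y[x,g]) on D has its values among those of a
on D', so it is constant and equals a y. Hence right multiplication by commutators does not change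
a. -/
theorem IsConnectedFor.commutator {A : Set (G → K)} (hA : IsTranslationStable A) {D : Subgroup G}
    (hD : IsConnectedFor A D) : IsConnectedFor A ⁅D, D⁆ := by
  intro a ha hfin
  have step : ∀ y ∈ ⁅D, D⁆, ∀ x ∈ D, ∀ g ∈ D, a (y * ⁅x, g⁆) = a y := by
    intro y hy x hx g hg
    have h1 := hD _ (hA.conj _ (hA.right _ (hA.left a ha y) g⁻¹) g) (hfin.subset ?_) x hx
    · simpa [commutatorElement_def, mul_assoc] using h1
    · rintro _ ⟨z, hz, rfl⟩
      exact ⟨y * ⁅z, g⁆, mul_mem hy (Subgroup.commutator_mem_commutator hz hg),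
        by simp [commutatorElement_def, mul_assoc]⟩
  intro x hx
  rw [Subgroup.commutator_def] at hx
  induction hx using Subgroup.closure_induction_right with
  | one => rfl
  | mul_right y hy s hs ih =>
    obtain ⟨g, hg, k, hk, rfl⟩ := hs
    rw [step y hy g hg k hk, ih]
  | mul_inv_cancel y hy s hs ih =>
    obtain ⟨g, hg, k, hk, rfl⟩ := hs
    rw [commutatorElement_inv, step y hy k hk g hg, ih]

end Connected

/-! ### The Lie–Kolchin theorem. -/

section LieKolchin

variable {G K V : Type*} [Group G] [Field K] [AddCommGroup V] [Module K V] [FiniteDimensional K V]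

theorem exists_minimal_invariant (ρ : G →* Module.End K V) (D : Subgroup G) (W : Submodule K V)
    (hW : W ≠ ⊥) (hinv : ∀ d ∈ D, ∀ w ∈ W, ρ d w ∈ W) :
    ∃ U ≤ W, U ≠ ⊥ ∧ (∀ d ∈ D, ∀ w ∈ U, ρ d w ∈ U) ∧
      ∀ U' ≤ U, U' ≠ ⊥ → (∀ d ∈ D, ∀ w ∈ U', ρ d w ∈ U') → U' = U := by
  obtain ⟨U, ⟨h1, h2, h3⟩, hmin⟩ := wellFounded_lt.has_min
    {U : Submodule K V | U ≤ W ∧ U ≠ ⊥ ∧ ∀ d ∈ D, ∀ w ∈ U, ρ d w ∈ U} ⟨W, le_rfl, hW, hinv⟩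
  refine ⟨U, h1, h2, h3, fun U' hU' h4 h5 => ?_⟩
  by_contra hne
  exact hmin U' ⟨hU'.trans h1, h4, h5⟩ (lt_of_le_of_ne hU' hne)

theorem exists_eigenvector_mem [IsAlgClosed K] (f : Module.End K V) {U : Submodule K V}
    (hU : U ≠ ⊥) (hf : ∀ w ∈ U, f w ∈ U) : ∃ c : K, ∃ u ∈ U, u ≠ 0 ∧ f u = c • u := by
  have : Nontrivial U := Submodule.nontrivial_iff_ne_bot.mpr hU
  obtain ⟨c, hc⟩ := Module.End.exists_eigenvalue (f.restrict hf)
  obtain ⟨u, hu⟩ := hc.exists_hasEigenvector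
  refine ⟨c, u, u.2, fun h => hu.2 (Subtype.ext h), ?_⟩
  simpa using congrArg Subtype.val hu.apply_eq_smul

/-- Lie–Kolchin: a connected soluble group over an algebraically closed field has a common
eigenvector in every nonzero invariant subspace. -/
theorem exists_common_eigenvector [IsAlgClosed K] {A : Set (G → K)} (hA : IsTranslationStable A)
    (ρ : G →* Module.End K V)
    (hcoef : ∀ (φ : Module.Dual K V) (v : V), (fun g => φ (ρ g v)) ∈ A) (n : ℕ) :
    ∀ D : Subgroup G, IsConnectedFor A D → (fun E : Subgroup G => ⁅E, E⁆)^[n] D = ⊥ →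
      ∀ W : Submodule K V, W ≠ ⊥ → (∀ d ∈ D, ∀ w ∈ W, ρ d w ∈ W) →
        ∃ w ∈ W, w ≠ 0 ∧ ∀ d ∈ D, ∃ c : K, ρ d w = c • w := by
  have hinvl : ∀ g v, ρ g⁻¹ (ρ g v) = v := fun g v => by
    rw [← Module.End.mul_apply, ← map_mul, inv_mul_cancel, map_one, Module.End.one_apply]
  have hne : ∀ g v, v ≠ 0 → ρ g v ≠ 0 := fun g v hv h => hv (by rw [← hinvl g v, h, map_zero])
  have hmul : ∀ g k v, ρ (g * k) v = ρ g (ρ k v) := fun g k v => by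
    rw [map_mul, Module.End.mul_apply]
  induction n with
  | zero =>
    intro D _ hD W hW _
    obtain ⟨w, hw, hw0⟩ := Submodule.exists_mem_ne_zero_of_ne_bot hW
    refine ⟨w, hw, hw0, fun d hd => ⟨1, ?_⟩⟩
    simp only [Function.iterate_zero, id_eq] at hD
    rw [hD, Subgroup.mem_bot] at hd
    simp [hd]
  | succ n ih =>
    intro D hDc hD W hW hWinv
    obtain ⟨U, hUW, hU0, hUinv, hUmin⟩ := exists_minimal_invariant ρ D W hW hWinv
    have hD'D : ⁅D, D⁆ ≤ D := D.commutator_le_self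
    obtain ⟨v, hvU, hv0, hv⟩ := ih ⁅D, D⁆ (hDc.commutator hA)
      (by simpa only [Function.iterate_succ_apply] using hD) U hU0
      (fun d hd => hUinv d (hD'D hd))
    obtain ⟨φ, hφ⟩ : ∃ φ : Module.Dual K V, φ v = 1 := by
      have : ¬ ∀ φ : Module.Dual K V, φ v = 0 :=
        fun h => hv0 ((Module.forall_dual_apply_eq_zero_iff K v).mp h)
      push Not at this
      obtain ⟨φ, hφ⟩ := this
      exact ⟨(φ v)⁻¹ • φ, by simp [hφ]⟩
    -- Normalizing φ v = 1 makes the weight of v on D' the restriction of a coefficient function, to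
    -- which connectedness applies.
    set χ : G → K := fun g => φ (ρ g v) with hχ
    have hχA : χ ∈ A := hcoef φ v
    have hχv : ∀ x ∈ ⁅D, D⁆, ρ x v = χ x • v := by
      intro x hx
      obtain ⟨c, hc⟩ := hv x hx
      simp [hχ, hc, hφ]
    have hnorm : ∀ x ∈ ⁅D, D⁆, ∀ d ∈ D, d⁻¹ * x * d ∈ ⁅D, D⁆ := by
      intro x hx d hd
      have : d⁻¹ * x * d = x * ⁅x⁻¹, d⁻¹⁆ := by simp [commutatorElement_def, mul_assoc]
      rw [this]
      exact mul_mem hx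
        (Subgroup.commutator_mem_commutator (inv_mem (hD'D hx)) (inv_mem hd))
    have hconj : ∀ x ∈ ⁅D, D⁆, ∀ d ∈ D, ∀ w, ρ x (ρ d w) = ρ d (ρ (d⁻¹ * x * d) w) := by
      intro x _ d _ w
      rw [← hmul, ← hmul]
      congr 2
      group
    -- These values are eigenvalues of ρ x, hence finite in number, and connectedness makes them
    -- constant in d. The weight space of χ is therefore D-invariant and, by minimality, all of U.
    have hχconj : ∀ x ∈ ⁅D, D⁆, ∀ d ∈ D, χ (d⁻¹ * x * d) = χ x := by
      intro x hx d hd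
      have h1 := hDc _ (hA.inv _ (hA.conj _ hχA x))
        ((Module.End.finite_hasEigenvalue (ρ x)).subset ?_) d hd
      · simpa using h1
      · rintro _ ⟨e, he, rfl⟩
        simp only [inv_inv]
        refine Module.End.hasEigenvalue_of_hasEigenvector (x := ρ e v)
          ⟨Module.End.mem_eigenspace_iff.mpr ?_, hne e v hv0⟩
        rw [hconj x hx e he, hχv _ (hnorm x hx e he), map_smul]
    have hχU : ∀ w ∈ U, ∀ x ∈ ⁅D, D⁆, ρ x w = χ x • w := by
      let U' : Submodule K V := U ⊓ ⨅ x ∈ ⁅D, D⁆, Module.End.eigenspace (ρ x) (χ x)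
      have hU'mem : ∀ w, w ∈ U' ↔ w ∈ U ∧ ∀ x ∈ ⁅D, D⁆, ρ x w = χ x • w := by
        intro w
        simp [U', Submodule.mem_iInf]
      have : U' = U := by
        refine hUmin U' inf_le_left (fun h => hv0 ?_) ?_
        · rw [← Submodule.mem_bot K, ← h]
          exact (hU'mem v).mpr ⟨hvU, hχv⟩
        · intro d hd w hw
          rw [hU'mem] at hw ⊢
          refine ⟨hUinv d hd w hw.1, fun x hx => ?_⟩
          rw [hconj x hx d hd, hw.2 _ (hnorm x hx d hd), map_smul, hχconj x hx d hd]
      intro w hw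
      rw [← this, hU'mem] at hw
      exact hw.2
    -- If u is an eigenvector of d for c, then ρ k u is one for c / χ [k,d]. So χ [k,d] takes
    -- finitely many values as k varies in D, and equals its value at k = 1.
    have hχ1 : ∀ d ∈ D, ∀ e ∈ D, χ ⁅e, d⁆ = 1 := by
      intro d hd e he
      obtain ⟨c, u, huU, hu0, hu⟩ := exists_eigenvector_mem (ρ d) hU0 (hUinv d hd)
      have hc0 : c ≠ 0 := fun h => hne d u hu0 (by rw [hu, h, zero_smul])
      have h1 := hDc _ (hA.conj _ (hA.right _ hχA d⁻¹) d)
        (((Module.End.finite_hasEigenvalue (ρ d)).image (fun μ => c / μ)).subset ?_) e he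
      · simpa [commutatorElement_def, mul_assoc, hχ, hφ] using h1
      · rintro _ ⟨k, hk, rfl⟩
        have hy : ⁅k, d⁆ ∈ ⁅D, D⁆ := Subgroup.commutator_mem_commutator hk hd
        have h2 : χ ⁅k, d⁆ • ρ d (ρ k u) = c • ρ k u := by
          rw [← hχU _ (hUinv d hd _ (hUinv k hk u huU)) _ hy, ← map_smul, ← hu, ← hmul, ← hmul,
            ← hmul]
          congr 2
          simp [commutatorElement_def, mul_assoc]
        have hχ0 : χ ⁅k, d⁆ ≠ 0 := by
          intro h
          rw [h, zero_smul] at h2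
          exact (smul_ne_zero hc0 (hne k u hu0)) h2.symm
        refine ⟨(χ ⁅k, d⁆)⁻¹ * c, ?_, ?_⟩
        · refine Module.End.hasEigenvalue_of_hasEigenvector (x := ρ k u)
            ⟨Module.End.mem_eigenspace_iff.mpr ?_, hne k u hu0⟩
          rw [mul_smul, ← h2, inv_smul_smul₀ hχ0]
        · change c / _ = χ (k * d * k⁻¹ * d⁻¹)
          rw [← commutatorElement_def]
          field_simp
    have hcomm : ∀ d ∈ D, ∀ e ∈ D, ∀ w ∈ U, ρ d (ρ e w) = ρ e (ρ d w) := by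
      intro d hd e he w hw
      have h1 := hχU _ (hUinv d hd _ (hUinv e he w hw)) ⁅e, d⁆
        (Subgroup.commutator_mem_commutator he hd)
      rw [hχ1 d hd e he, one_smul] at h1
      rw [← h1, ← hmul, ← hmul, ← hmul]
      congr 2
      simp [commutatorElement_def, mul_assoc]
    refine ⟨v, hUW hvU, hv0, fun d hd => ?_⟩
    obtain ⟨c, u, huU, hu0, hu⟩ := exists_eigenvector_mem (ρ d) hU0 (hUinv d hd)
    refine ⟨c, ?_⟩
    -- D acts on U through commuting operators, so an eigenspace of d in U is D-invariant and
    -- minimality applies again.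
    have : U ⊓ Module.End.eigenspace (ρ d) c = U := by
      refine hUmin _ inf_le_left (fun h => hu0 ?_) ?_
      · rw [← Submodule.mem_bot K, ← h]
        exact ⟨huU, Module.End.mem_eigenspace_iff.mpr hu⟩
      · rintro e he w ⟨hwU, hw⟩
        have hw : ρ d w = c • w := Module.End.mem_eigenspace_iff.mp hw
        refine ⟨hUinv e he w hwU, Module.End.mem_eigenspace_iff.mpr ?_⟩
        rw [hcomm d hd e he w hwU, hw, map_smul]
    rw [← this] at hvU
    exact Module.End.mem_eigenspace_iff.mp hvU.2

end LieKolchin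


/-! ### Unipotence of the derived group of a connected soluble group. -/

section Flag

/-- The action of `ρ` on the quotient by an invariant subspace. -/
def quotientAction {G K V : Type*} [Group G] [Field K] [AddCommGroup V] [Module K V]
    (ρ : G →* Module.End K V) (L : Submodule K V) (h : ∀ g, L ≤ L.comap (ρ g)) :
    G →* Module.End K (V ⧸ L) where
  toFun g := L.mapQ L (ρ g) (h g)
  map_one' := by
    ext v
    simp
  map_mul' g k := by
    ext v
    simp

theorem derivedSeries_eq_iterate {G : Type*} [Group G] (n : ℕ) :
    derivedSeries G n = (fun E : Subgroup G => ⁅E, E⁆)^[n] ⊤ := by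
  induction n with
  | zero => rfl
  | succ n ih => rw [Function.iterate_succ_apply', ← ih, derivedSeries_succ]

/-- The derived group of a connected soluble linear group over an algebraically closed field is
unipotent. -/
theorem exists_augSet_pow_of_connected {G K : Type*} [Group G] [Group.IsSolvable G] [Field K]
    [IsAlgClosed K] {A : Set (G → K)} (hA : IsTranslationStable A) (hG : IsConnectedFor A ⊤)
    (d : ℕ) : ∀ (V : Type*) [AddCommGroup V] [Module K V] [FiniteDimensional K V]
      (ρ : G →* Module.End K V), (∀ (φ : Module.Dual K V) (v : V), (fun g => φ (ρ g v)) ∈ A) →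
      Module.finrank K V = d → ∃ m, augSet ρ (commutator G) ^ m ⊆ {0} := by
  induction d using Nat.strong_induction_on with
  | _ d ih =>
    intro V _ _ _ ρ hcoef hd
    by_cases hV : (⊤ : Submodule K V) = ⊥
    · have : Subsingleton V := (Submodule.subsingleton_iff K).mp (subsingleton_of_bot_eq_top hV.symm)
      exact ⟨0, fun x _ => Subsingleton.elim _ _⟩
    obtain ⟨n, hn⟩ := Group.IsSolvable.solvable (G := G)
    obtain ⟨v, -, hv0, hv⟩ := exists_common_eigenvector hA ρ hcoef n ⊤ hG
      (by rw [← derivedSeries_eq_iterate, hn]) ⊤ hV (fun _ _ _ _ => Submodule.mem_top)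
    choose c hc using fun g => hv g (Subgroup.mem_top g)
    have hL : ∀ g, K ∙ v ≤ (K ∙ v).comap (ρ g) := by
      intro g
      rw [Submodule.span_singleton_le_iff_mem, Submodule.mem_comap, hc g]
      exact Submodule.smul_mem _ _ (Submodule.mem_span_singleton_self v)
    let χ : G →* K :=
      { toFun := c
        map_one' := by
          have h := hc 1
          rw [map_one, Module.End.one_apply] at h
          exact smul_left_injective K hv0 (by simpa using h.symm)
        map_mul' := fun g k => by
          have h := hc (g * k)
          rw [map_mul, Module.End.mul_apply, hc k, map_smul, hc g, smul_smul, mul_comm] at h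
          exact smul_left_injective K hv0 h.symm }
    have hχ : ∀ g ∈ commutator G, c g = 1 := by
      intro g hg
      have h1 := Abelianization.commutator_subset_ker χ.toHomUnits hg
      rw [MonoidHom.mem_ker] at h1
      simpa [χ] using congrArg Units.val h1
    obtain ⟨m, hm⟩ := ih (Module.finrank K (V ⧸ K ∙ v)) (by
        rw [← hd]
        have h1 := (K ∙ v).finrank_quotient_add_finrank
        rw [finrank_span_singleton hv0] at h1
        omega)
      (V ⧸ K ∙ v) (quotientAction ρ _ hL) (by
        intro φ w
        obtain ⟨w, rfl⟩ := Submodule.mkQ_surjective _ w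
        exact hcoef (φ ∘ₗ (K ∙ v).mkQ) w) rfl
    -- The first m factors send V into the line spanned by v; the extra one kills that line, since
    -- the character c is trivial on the derived group.
    refine ⟨m + 1, ?_⟩
    have hquot : ∀ k, ∀ x ∈ augSet ρ (commutator G) ^ k,
        ∃ y ∈ augSet (quotientAction ρ _ hL) (commutator G) ^ k,
          ∀ w, (K ∙ v).mkQ (x w) = y ((K ∙ v).mkQ w) := by
      intro k
      induction k with
      | zero => exact fun x hx => ⟨1, by simp, by simp_all⟩
      | succ k ihk =>
        rintro x hx
        rw [pow_succ] at hx
        obtain ⟨x, hx, _, ⟨g, hg, rfl⟩, rfl⟩ := hx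
        obtain ⟨y, hy, hxy⟩ := ihk x hx
        refine ⟨y * (quotientAction ρ _ hL g - 1), ?_, fun w => ?_⟩
        · rw [pow_succ]
          exact Set.mul_mem_mul hy ⟨g, hg, rfl⟩
        · simp only [Module.End.mul_apply, hxy]
          rfl
    rw [pow_succ']
    rintro _ ⟨_, ⟨g, hg, rfl⟩, x, hx, rfl⟩
    obtain ⟨y, hy, hxy⟩ := hquot m x hx
    rw [Set.mem_singleton_iff]
    ext w
    have h1 : x w ∈ K ∙ v := by
      rw [← Submodule.ker_mkQ (K ∙ v), LinearMap.mem_ker, hxy, hm hy, LinearMap.zero_apply]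
    obtain ⟨b, hb⟩ := Submodule.mem_span_singleton.mp h1
    simp [← hb, hc g, hχ g hg]

end Flag

/-! ### The identity component via idempotents, and the linear case. -/

section FiniteIndex

theorem Subgroup.finiteIndex_of_fibers {G X : Type*} [Group G] (H : Subgroup G) [Finite X]
    (f : G → X) (h : ∀ g k, f g = f k → g⁻¹ * k ∈ H) : H.FiniteIndex := by
  have : Finite (G ⧸ H) := by
    refine Finite.of_injective (fun q : G ⧸ H => f q.out) fun p q hpq => ?_
    rw [← Quotient.out_eq' p, ← Quotient.out_eq' q]
    exact QuotientGroup.eq.mpr (h _ _ hpq)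
  exact Subgroup.finiteIndex_of_finite_quotient

/-- A noetherian ring has only finitely many idempotents. -/
theorem finite_isIdempotentElem {A : Type*} [CommRing A] [IsNoetherianRing A] :
    {e : A | IsIdempotentElem e}.Finite := by
  have hle : ∀ e f : A, IsIdempotentElem e → IsIdempotentElem f →
      (∀ P ∈ minimalPrimes A, e ∈ P → f ∈ P) → f = e * f := by
    intro e f he hf h
    -- This idempotent lies in every minimal prime, so it is nilpotent and hence zero. An idempotent
    -- is thus determined by the minimal primes containing it.
    have hid : IsIdempotentElem (f * (1 - e)) := hf.mul he.one_sub
    have hnil : f * (1 - e) ∈ nilradical A := by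
      rw [nilradical, ← Ideal.sInf_minimalPrimes, Submodule.mem_sInf]
      intro (P : Ideal A) hP
      have hprime : P.IsPrime := hP.1.1
      by_cases heP : e ∈ P
      · exact P.mul_mem_right _ (h P hP heP)
      · refine P.mul_mem_left _ ((hprime.mem_or_mem ?_).resolve_left heP)
        rw [mul_sub, mul_one, he.eq, sub_self]
        exact P.zero_mem
    obtain ⟨n, hn⟩ := (mem_nilradical.mp hnil)
    have h0 : f * (1 - e) = 0 := by
      have h1 := hid.pow_succ_eq n
      rw [pow_succ, hn, zero_mul] at h1
      exact h1.symm
    linear_combination h0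
  have hfin : Finite (minimalPrimes A) := (minimalPrimes.finite_of_isNoetherianRing A).to_subtype
  have : Finite {e : A | IsIdempotentElem e} := by
    refine Finite.of_injective
      (fun e => ({P | (e : A) ∈ (P : Ideal A)} : Set (minimalPrimes A))) ?_
    rintro ⟨e, he⟩ ⟨f, hf⟩ hef
    have hiff : ∀ P ∈ minimalPrimes A, e ∈ P ↔ f ∈ P := fun P hP =>
      Set.ext_iff.mp hef ⟨P, hP⟩
    refine Subtype.ext ?_
    have h1 := hle e f he hf fun P hP => (hiff P hP).mp
    have h2 := hle f e hf he fun P hP => (hiff P hP).mpr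
    exact h2.trans ((mul_comm f e).trans h1.symm)
  exact Set.toFinite _

variable {G K ι : Type*} [Group G] [Field K] [Fintype ι] [DecidableEq ι]

/-- The algebra of functions on `G` generated by the matrix entries of `g` and of `g⁻¹`. -/
def coefAlgebra (M : G →* Matrix ι ι K) : Subalgebra K (G → K) :=
  Algebra.adjoin K (Set.range (fun (p : ι × ι) g => M g p.1 p.2) ∪
    Set.range (fun (p : ι × ι) g => M g⁻¹ p.1 p.2))

/-- The self-maps of `G` whose matrix entries, and those of the inverse, are in `coefAlgebra M`. -/
def IsRegularMap (M : G →* Matrix ι ι K) (w : G → G) : Prop :=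
  ∀ i j, (fun g => M (w g) i j) ∈ coefAlgebra M ∧ (fun g => M (w g)⁻¹ i j) ∈ coefAlgebra M

variable {M : G →* Matrix ι ι K}

theorem isRegularMap_id : IsRegularMap M id := fun i j =>
  ⟨Algebra.subset_adjoin (Or.inl ⟨(i, j), rfl⟩), Algebra.subset_adjoin (Or.inr ⟨(i, j), rfl⟩)⟩

theorem isRegularMap_const (x : G) : IsRegularMap M fun _ => x := fun i j =>
  ⟨(coefAlgebra M).algebraMap_mem (M x i j), (coefAlgebra M).algebraMap_mem (M x⁻¹ i j)⟩

theorem IsRegularMap.inv {w : G → G} (h : IsRegularMap M w) : IsRegularMap M fun g => (w g)⁻¹ :=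
  fun i j => ⟨(h i j).2, by simpa using (h i j).1⟩

theorem IsRegularMap.mul {w z : G → G} (hw : IsRegularMap M w) (hz : IsRegularMap M z) :
    IsRegularMap M fun g => w g * z g := by
  have key : ∀ a b : G → G, (∀ i j, (fun g => M (a g) i j) ∈ coefAlgebra M) →
      (∀ i j, (fun g => M (b g) i j) ∈ coefAlgebra M) →
      ∀ i j, (fun g => M (a g * b g) i j) ∈ coefAlgebra M := by
    intro a b ha hb i j
    have : (fun g => M (a g * b g) i j) =
        ∑ k, (fun g => M (a g) i k) * fun g => M (b g) k j := by
      ext g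
      simp [Matrix.mul_apply]
    rw [this]
    exact sum_mem fun k _ => mul_mem (ha i k) (hb k j)
  refine fun i j => ⟨key w z (fun i j => (hw i j).1) (fun i j => (hz i j).1) i j, ?_⟩
  simp only [mul_inv_rev]
  exact key _ _ (fun i j => (hz i j).2) (fun i j => (hw i j).2) i j

theorem IsRegularMap.comp_mem {w : G → G} (hw : IsRegularMap M w) {a : G → K}
    (ha : a ∈ coefAlgebra M) : (fun g => a (w g)) ∈ coefAlgebra M := by
  induction ha using Algebra.adjoin_induction with
  | mem a ha =>
    rcases ha with ⟨p, rfl⟩ | ⟨p, rfl⟩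
    · exact (hw p.1 p.2).1
    · exact (hw p.1 p.2).2
  | algebraMap r => exact (coefAlgebra M).algebraMap_mem r
  | add a b _ _ ha hb => exact add_mem ha hb
  | mul a b _ _ ha hb => exact mul_mem ha hb

theorem isTranslationStable_coefAlgebra :
    IsTranslationStable (coefAlgebra M : Set (G → K)) where
  inv _ ha := isRegularMap_id.inv.comp_mem ha
  left _ ha g := ((isRegularMap_const g).mul isRegularMap_id).comp_mem ha
  right _ ha g := (isRegularMap_id.mul (isRegularMap_const g)).comp_mem ha
  conj _ ha g := ((isRegularMap_id.mul (isRegularMap_const g)).mul isRegularMap_id.inv).comp_mem ha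

variable (M) in
theorem finite_idempotents_coefAlgebra :
    {e : G → K | e ∈ coefAlgebra M ∧ IsIdempotentElem e}.Finite := by
  have hfg : (coefAlgebra M).FG :=
    Subalgebra.fg_def.mpr ⟨_, (Set.finite_range _).union (Set.finite_range _), rfl⟩
  have : Algebra.FiniteType K (coefAlgebra M) := (Subalgebra.fg_iff_finiteType _).mp hfg
  have : IsNoetherianRing (coefAlgebra M) := Algebra.FiniteType.isNoetherianRing K _
  refine ((finite_isIdempotentElem (A := coefAlgebra M)).image Subtype.val).subset ?_
  rintro e ⟨he, hid⟩
  exact ⟨⟨e, he⟩, Subtype.ext hid, rfl⟩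

variable (M) in
/-- The elements that fix all idempotents of `coefAlgebra M` under two-sided translation. -/
def idempotentStabilizer : Subgroup G where
  carrier := {h | ∀ e ∈ coefAlgebra M, IsIdempotentElem e → ∀ x, e (x * h) = e x}
  one_mem' := fun e _ _ x => by rw [mul_one]
  mul_mem' := fun ha hb e he hid x => by rw [← mul_assoc, hb e he hid, ha e he hid]
  inv_mem' := fun {a} ha e he hid x => by
    rw [← ha e he hid (x * a⁻¹), inv_mul_cancel_right]

theorem isIdempotentElem_comp {X R : Type*} [Mul R] {e : X → R} (he : IsIdempotentElem e)
    (w : X → X) :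
    IsIdempotentElem fun g => e (w g) :=
  funext fun g => congrFun he (w g)

variable (M) in
theorem finiteIndex_idempotentStabilizer : (idempotentStabilizer M).FiniteIndex := by
  let E := {e : G → K | e ∈ coefAlgebra M ∧ IsIdempotentElem e}
  have : Finite E := (finite_idempotents_coefAlgebra M).to_subtype
  refine Subgroup.finiteIndex_of_fibers (X := E → E) _ (fun g e => ⟨fun x => (e : G → K) (x * g),
    isTranslationStable_coefAlgebra.right _ e.2.1 g, isIdempotentElem_comp e.2.2 _⟩) ?_
  intro g k hgk e he hid x
  have h1 := congrFun (congrArg Subtype.val (congrFun hgk ⟨e, he, hid⟩)) (x * g⁻¹)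
  simpa [mul_assoc] using h1.symm

/-- The indicator function of `idempotentStabilizer M` lies in `coefAlgebra M`. -/
theorem exists_indicator_idempotentStabilizer : ∃ e ∈ coefAlgebra M, IsIdempotentElem e ∧
    (∀ h ∈ idempotentStabilizer M, e h = 1) ∧ ∀ x ∉ idempotentStabilizer M, e x = 0 := by
  have hval : ∀ {e : G → K}, IsIdempotentElem e → ∀ x, e x = 0 ∨ e x = 1 := fun he x =>
    IsIdempotentElem.iff_eq_zero_or_one.mp (congrFun he x)
  have hsep : ∀ x ∉ idempotentStabilizer M, ∃ e ∈ coefAlgebra M, IsIdempotentElem e ∧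
      e 1 = 1 ∧ e x = 0 := by
    intro x hx
    have : ¬ ∀ e ∈ coefAlgebra M, IsIdempotentElem e → ∀ y, e (y * x) = e y := hx
    push Not at this
    obtain ⟨e, he, hid, y, hy⟩ := this
    have hf : (fun z => e (y * z)) ∈ coefAlgebra M :=
      isTranslationStable_coefAlgebra.left e he y
    have hfid : IsIdempotentElem fun z => e (y * z) := isIdempotentElem_comp hid _
    -- The translate by y separates 1 from x; it is replaced by its complement when it vanishes at
    -- 1.
    rcases hval hid y with h0 | h1
    · refine ⟨1 - fun z => e (y * z), sub_mem (one_mem _) hf, hfid.one_sub, by simp [h0], ?_⟩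
      have := (hval hid (y * x)).resolve_left (fun h => hy (h.trans h0.symm))
      simp [this]
    · refine ⟨fun z => e (y * z), hf, hfid, by simp [h1], ?_⟩
      exact (hval hid (y * x)).resolve_right (fun h => hy (h.trans h1.symm))
  have hfin : {e : G → K | e ∈ coefAlgebra M ∧ IsIdempotentElem e ∧ e 1 = 1}.Finite :=
    (finite_idempotents_coefAlgebra M).subset fun e he => ⟨he.1, he.2.1⟩
  -- The product of all idempotents equal to 1 at the identity: the indicator of the component of 1.
  refine ⟨∏ e ∈ hfin.toFinset, e, ?_, ?_, ?_, ?_⟩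
  · exact prod_mem fun e he => (hfin.mem_toFinset.mp he).1
  · unfold IsIdempotentElem
    rw [← Finset.prod_mul_distrib]
    exact Finset.prod_congr rfl fun e he => (hfin.mem_toFinset.mp he).2.1
  · intro h hh
    rw [Finset.prod_apply]
    refine Finset.prod_eq_one fun e he => ?_
    obtain ⟨heA, hid, h1⟩ := hfin.mem_toFinset.mp he
    rw [← h1, ← hh e heA hid 1, one_mul]
  · intro x hx
    obtain ⟨e, he, hid, h1, h0⟩ := hsep x hx
    rw [Finset.prod_apply]
    exact Finset.prod_eq_zero (hfin.mem_toFinset.mpr ⟨he, hid, h1⟩) h0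

-- Lagrange interpolation on the finitely many values of a gives p, equal to 1 where a = a 1 and to
-- 0 elsewhere on the stabilizer. The indicator e removes the points outside, where a is
-- uncontrolled. Then p * e is an idempotent, so translation by x cannot change its value at 1.
variable (M) in
theorem isConnectedFor_idempotentStabilizer :
    IsConnectedFor (coefAlgebra M : Set (G → K)) (idempotentStabilizer M) := by
  classical
  intro a ha hfin x hx
  obtain ⟨e, he, hid, he1, he0⟩ := exists_indicator_idempotentStabilizer (M := M)
  have h1H : (1 : G) ∈ idempotentStabilizer M := one_mem _
  let p : G → K := ∏ c ∈ hfin.toFinset.erase (a 1), fun g => (a 1 - c)⁻¹ * (a g - c)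
  have hpA : p ∈ coefAlgebra M := prod_mem fun c _ =>
    mul_mem ((coefAlgebra M).algebraMap_mem (a 1 - c)⁻¹)
      (sub_mem ha ((coefAlgebra M).algebraMap_mem c))
  have hp1 : ∀ g, a g = a 1 → p g = 1 := by
    intro g hg
    simp only [p, Finset.prod_apply]
    refine Finset.prod_eq_one fun c hc => ?_
    rw [hg, inv_mul_cancel₀ (sub_ne_zero.mpr (Finset.ne_of_mem_erase hc).symm)]
  have hp0 : ∀ g ∈ idempotentStabilizer M, a g ≠ a 1 → p g = 0 := by
    intro g hg hne
    simp only [p, Finset.prod_apply]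
    refine Finset.prod_eq_zero (i := a g) ?_ (by simp)
    exact Finset.mem_erase.mpr ⟨hne, hfin.mem_toFinset.mpr ⟨g, hg, rfl⟩⟩
  have hq : IsIdempotentElem (p * e) := by
    ext g
    by_cases hg : g ∈ idempotentStabilizer M
    · by_cases h : a g = a 1
      · simp [hp1 g h, he1 g hg]
      · simp [hp0 g hg h]
    · simp [he0 g hg]
  by_contra hne
  have h2 := hx (p * e) (mul_mem hpA he) hq 1
  simp [he1 x hx, he1 1 h1H, hp0 x hx hne, hp1 1 rfl] at h2

/-- Every soluble linear group over an algebraically closed field has a subgroup of finite index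
whose derived group is unipotent. -/
theorem exists_finiteIndex_augSet_pow_of_isAlgClosed [IsAlgClosed K] [Group.IsSolvable G]
    (M : G →* Matrix ι ι K) :
    ∃ H : Subgroup G, H.FiniteIndex ∧ ∃ m, augSet M ⁅H, H⁆ ^ m ⊆ {0} := by
  set H := idempotentStabilizer M with hH
  refine ⟨H, finiteIndex_idempotentStabilizer M, ?_⟩
  -- Restricting the coefficient functions makes H itself the connected ambient group.
  let A : Set (H → K) := (fun a h => a (h : G)) '' (coefAlgebra M : Set (G → K))
  have hstab := isTranslationStable_coefAlgebra (M := M)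
  have hA : IsTranslationStable A :=
    { inv := by rintro _ ⟨a, ha, rfl⟩; exact ⟨_, hstab.inv a ha, rfl⟩
      left := by rintro _ ⟨a, ha, rfl⟩ g; exact ⟨_, hstab.left a ha g, rfl⟩
      right := by rintro _ ⟨a, ha, rfl⟩ g; exact ⟨_, hstab.right a ha g, rfl⟩
      conj := by rintro _ ⟨a, ha, rfl⟩ g; exact ⟨_, hstab.conj a ha g, rfl⟩ }
  have hc : IsConnectedFor A ⊤ := by
    rintro _ ⟨a, ha, rfl⟩ hfin x -
    refine isConnectedFor_idempotentStabilizer M a ha (hfin.subset ?_) x x.2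
    rintro _ ⟨y, hy, rfl⟩
    exact ⟨⟨y, hy⟩, trivial, rfl⟩
  let e : Matrix ι ι K ≃ₐ[K] Module.End K (ι → K) := Matrix.toLinAlgEquiv'
  let ρ : H →* Module.End K (ι → K) := (e : Matrix ι ι K →* Module.End K (ι → K)).comp
    (M.comp H.subtype)
  obtain ⟨m, hm⟩ := exists_augSet_pow_of_connected hA hc _ (ι → K) ρ (by
    intro φ v
    refine ⟨fun g => φ (M g *ᵥ v), ?_, rfl⟩
    have : (fun g => φ (M g *ᵥ v)) =
        ∑ i, ∑ j, (φ (fun j => if i = j then 1 else 0) * v j) • fun g => M g i j := by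
      ext g
      rw [LinearMap.pi_apply_eq_sum_univ φ]
      simp only [Matrix.mulVec, dotProduct, Finset.sum_apply, Pi.smul_apply, smul_eq_mul,
        Finset.sum_mul]
      refine Finset.sum_congr rfl fun i _ => Finset.sum_congr rfl fun j _ => ?_
      ring
    rw [this]
    exact sum_mem fun i _ => sum_mem fun j _ =>
      (coefAlgebra M).smul_mem ((isRegularMap_id (M := M) i j).1) _) rfl
  refine ⟨m, ?_⟩
  rw [← augSet_comp_subtype]
  intro x hx
  have h1 : e x ∈ augSet ρ (commutator H) ^ m := by
    have h2 := image_augSet (e : Matrix ι ι K →+* Module.End K (ι → K)) (M.comp H.subtype)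
      (commutator H)
    change _ = augSet ρ _ at h2
    rw [← h2, ← Set.image_pow]
    exact ⟨x, hx, rfl⟩
  simpa using hm h1

/-- Every soluble linear group has a subgroup of finite index whose derived group is unipotent. -/
theorem exists_finiteIndex_augSet_pow [Group.IsSolvable G] (M : G →* Matrix ι ι K) :
    ∃ H : Subgroup G, H.FiniteIndex ∧ ∃ m, augSet M ⁅H, H⁆ ^ m ⊆ {0} := by
  let f : Matrix ι ι K →+* Matrix ι ι (AlgebraicClosure K) :=
    (algebraMap K (AlgebraicClosure K)).mapMatrix
  have hf : Function.Injective f :=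
    Matrix.map_injective (algebraMap K (AlgebraicClosure K)).injective
  obtain ⟨H, hH, m, hm⟩ := exists_finiteIndex_augSet_pow_of_isAlgClosed
    ((f : Matrix ι ι K →* Matrix ι ι (AlgebraicClosure K)).comp M)
  refine ⟨H, hH, m, fun x hx => ?_⟩
  rw [← image_augSet, ← Set.image_pow] at hm
  exact hf ((hm ⟨x, hx, rfl⟩).trans (map_zero f).symm)

/-- The same for the action on a finite-dimensional vector space. -/
theorem exists_finiteIndex_augSet_pow_of_finiteDimensional [Group.IsSolvable G] {V : Type*}
    [AddCommGroup V] [Module K V] [FiniteDimensional K V] (ρ : G →* Module.End K V) :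
    ∃ H : Subgroup G, H.FiniteIndex ∧ ∃ m, augSet ρ ⁅H, H⁆ ^ m ⊆ {0} := by
  let ι := Fin (Module.finrank K V)
  let e : Module.End K V ≃ₐ[K] Matrix ι ι K :=
    LinearMap.toMatrixAlgEquiv (Module.finBasis K V)
  obtain ⟨H, hH, m, hm⟩ := exists_finiteIndex_augSet_pow
    ((e : Module.End K V →* Matrix ι ι K).comp ρ)
  refine ⟨H, hH, m, fun x hx => ?_⟩
  have h2 := image_augSet (e : Module.End K V →+* Matrix ι ι K) ρ ⁅H, H⁆
  change _ = augSet ((e : Module.End K V →* Matrix ι ι K).comp ρ) _ at h2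
  rw [← h2, ← Set.image_pow] at hm
  simpa using hm ⟨x, hx, rfl⟩

theorem hasPropertyR_of_linear {K V : Type*} [Field K] [AddCommGroup V] [Module K V]
    [FiniteDimensional K V] (G : Subgroup (LinearMap.GeneralLinearGroup K V))
    [Group.IsSolvable G] : HasPropertyR G := by
  let ρ : G →* Module.End K V := (Units.coeHom _).comp G.subtype
  obtain ⟨H, hH, m, hm⟩ := exists_finiteIndex_augSet_pow_of_finiteDimensional ρ
  refine ⟨H, hH, isNilpotent_commutator_of_lowerCentralSeries
    (lowerCentralSeries_eq_bot_of_augSet_pow (ρ := ρ) ?_ hm)⟩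
  exact Units.val_injective.comp Subtype.val_injective

end FiniteIndex


/-! ### Actions on finitely generated abelian groups. -/

section FinitelyGeneratedModule

open scoped TensorProduct

theorem mem_torsion_of_one_tmul_eq_zero {M : Type*} [AddCommGroup M] {x : M}
    (h : (1 : ℚ) ⊗ₜ[ℤ] x = 0) : x ∈ Submodule.torsion ℤ M := by
  have h1 : TensorProduct.mk ℤ ℚ M 1 x = 0 := h
  rw [IsLocalizedModule.eq_zero_iff (nonZeroDivisors ℤ)] at h1
  exact h1

/-- A soluble group acting on a finitely generated abelian group has a subgroup of finite index
whose derived group acts unipotently. -/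
theorem exists_finiteIndex_augSet_pow_of_int {G M : Type*} [Group G] [Group.IsSolvable G]
    [AddCommGroup M] [Module.Finite ℤ M] (ρ : G →* Module.End ℤ M) :
    ∃ H : Subgroup G, H.FiniteIndex ∧ ∃ m, augSet ρ ⁅H, H⁆ ^ m ⊆ {0} := by
  let b : Module.End ℤ M →+* Module.End ℚ (ℚ ⊗[ℤ] M) := (Module.End.baseChangeHom ℤ ℚ M).toRingHom
  obtain ⟨H₁, hH₁, m, hm⟩ := exists_finiteIndex_augSet_pow_of_finiteDimensional
    ((b : Module.End ℤ M →* Module.End ℚ (ℚ ⊗[ℤ] M)).comp ρ)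
  rw [← image_augSet, ← Set.image_pow] at hm
  have htors : ∀ s ∈ augSet ρ ⁅H₁, H₁⁆ ^ m, ∀ x, s x ∈ Submodule.torsion ℤ M := by
    intro s hs x
    apply mem_torsion_of_one_tmul_eq_zero
    have h1 : b s = 0 := hm ⟨s, hs, rfl⟩
    exact LinearMap.congr_fun h1 (1 ⊗ₜ x)
  have hfin : Finite (Submodule.torsion ℤ M) :=
    Module.finite_of_fg_torsion _ (Submodule.torsion_isTorsion)
  have hmap : ∀ (f : Module.End ℤ M), ∀ t ∈ Submodule.torsion ℤ M,
      f t ∈ Submodule.torsion ℤ M := by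
    rintro f t ⟨a, ha⟩
    refine ⟨a, ?_⟩
    rw [Submonoid.smul_def] at ha ⊢
    rw [← map_smul, ha, map_zero]
  -- Over ℚ only unipotence modulo torsion is visible. The torsion is finite, so its pointwise
  -- stabilizer has finite index; inside it one further factor ρ g - 1 kills the torsion.
  let H₂ : Subgroup G :=
    { carrier := {g | ∀ t ∈ Submodule.torsion ℤ M, ρ g t = t}
      one_mem' := fun t _ => by simp
      mul_mem' := fun ha hb t ht => by rw [map_mul, Module.End.mul_apply, hb t ht, ha t ht]
      inv_mem' := fun {a} ha t ht => by
        conv_lhs => rw [← ha t ht]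
        rw [← Module.End.mul_apply, ← map_mul, inv_mul_cancel, map_one, Module.End.one_apply] }
  have hH₂ : H₂.FiniteIndex := by
    refine Subgroup.finiteIndex_of_fibers H₂
      (X := Submodule.torsion ℤ M → Submodule.torsion ℤ M)
      (fun g t => ⟨ρ g t, hmap _ _ t.2⟩) fun g k hgk t ht => ?_
    have h1 : ρ g t = ρ k t := congrArg Subtype.val (congrFun hgk ⟨t, ht⟩)
    rw [map_mul, Module.End.mul_apply, ← h1, ← Module.End.mul_apply, ← map_mul, inv_mul_cancel,
      map_one, Module.End.one_apply]
  refine ⟨H₁ ⊓ H₂, inferInstance, m + 1, ?_⟩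
  have hle₁ : ⁅H₁ ⊓ H₂, H₁ ⊓ H₂⁆ ≤ ⁅H₁, H₁⁆ := Subgroup.commutator_mono inf_le_left inf_le_left
  have hle₂ : ⁅H₁ ⊓ H₂, H₁ ⊓ H₂⁆ ≤ H₂ := (Subgroup.commutator_le_self _).trans inf_le_right
  rw [pow_succ']
  rintro _ ⟨_, ⟨g, hg, rfl⟩, s, hs, rfl⟩
  rw [Set.mem_singleton_iff]
  ext x
  have h1 := htors s (Set.pow_subset_pow_left (augSet_mono ρ hle₁) hs) x
  have h2 : ρ g (s x) = s x := hle₂ hg _ h1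
  simp [h2]

end FinitelyGeneratedModule

/-! ### From unipotent action on A/A' to iterated commutators. -/

section Abelianization

variable {G : Type*} [Group G]

/-- The conjugation action of `G` on the abelianization of a normal subgroup. -/
def abelianizationAction (A : Subgroup G) [A.Normal] :
    G →* Module.End ℤ (Additive (Abelianization A)) where
  toFun g := (MonoidHom.toAdditive
    (Abelianization.map (MulAut.conjNormal g : A ≃* A).toMonoidHom)).toIntLinearMap
  map_one' := by
    ext x
    obtain ⟨x, rfl⟩ := Additive.ofMul.surjective x
    obtain ⟨x, rfl⟩ := QuotientGroup.mk_surjective x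
    change Additive.ofMul (Abelianization.map _ (Abelianization.of x)) = _
    rw [Abelianization.map_of]
    simp
    rfl
  map_mul' g k := by
    ext x
    obtain ⟨x, rfl⟩ := Additive.ofMul.surjective x
    obtain ⟨x, rfl⟩ := QuotientGroup.mk_surjective x
    change Additive.ofMul (Abelianization.map _ (Abelianization.of x)) =
      Additive.ofMul (Abelianization.map _ (Abelianization.map _ (Abelianization.of x)))
    rw [Abelianization.map_of, Abelianization.map_of, Abelianization.map_of]
    simp

theorem abelianizationAction_of (A : Subgroup G) [A.Normal] (g : G) (a : A) :
    abelianizationAction A g (Additive.ofMul (Abelianization.of a)) =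
      Additive.ofMul (Abelianization.of (MulAut.conjNormal g a)) := rfl

/-- If `N` acts unipotently on the abelianization of `A`, then repeated commutators of `A` with `N`
end up in the derived group of `A`. -/
theorem iterate_commutator_le {A : Subgroup G} [A.Normal] {N : Subgroup G} {m : ℕ}
    (h : augSet (abelianizationAction A) N ^ m ⊆ {0}) :
    (fun X : Subgroup G => ⁅X, N⁆)^[m] A ≤ ⁅A, A⁆ := by
  set S := augSet (abelianizationAction A) N with hS
  let cls : A →* Abelianization A := Abelianization.of
  -- A filtration from C 0 = A' up to C m = A. Since [a,g] has class -(g - 1)a in A/A', commutation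
  -- with N lowers the index by one.
  let C : ℕ → Subgroup A := fun k =>
    { carrier := {a | ∀ s ∈ S ^ k, s (Additive.ofMul (cls a)) = 0}
      one_mem' := fun s _ => by simp
      mul_mem' := fun ha hb s hs => by rw [map_mul, ofMul_mul, map_add, ha s hs, hb s hs, add_zero]
      inv_mem' := fun ha s hs => by rw [map_inv, ofMul_inv, map_neg, ha s hs, neg_zero] }
  have hC : ∀ k, ⁅(C (k + 1)).map A.subtype, N⁆ ≤ (C k).map A.subtype := by
    intro k
    rw [Subgroup.commutator_le]
    rintro _ ⟨a, ha, rfl⟩ g hg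
    refine ⟨a * MulAut.conjNormal g a⁻¹, fun s hs => ?_, ?_⟩
    · have h1 := ha (s * (abelianizationAction A g - 1)) (by
        rw [pow_succ]
        exact Set.mul_mem_mul hs ⟨g, hg, rfl⟩)
      rw [Module.End.mul_apply, LinearMap.sub_apply, abelianizationAction_of,
        Module.End.one_apply, map_sub, sub_eq_zero] at h1
      rw [map_mul, map_inv, map_inv, ofMul_mul, ofMul_inv, map_add, map_neg, ← sub_eq_add_neg,
        sub_eq_zero]
      exact h1.symm
    · simp [commutatorElement_def, mul_assoc]
  have hiter : ∀ k, (fun X : Subgroup G => ⁅X, N⁆)^[k] ((C k).map A.subtype) ≤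
      (C 0).map A.subtype := by
    intro k
    induction k with
    | zero => exact le_rfl
    | succ k ih =>
      rw [Function.iterate_succ_apply]
      have hmono : Monotone fun X : Subgroup G => ⁅X, N⁆ := fun X Y hXY =>
        Subgroup.commutator_mono hXY le_rfl
      exact (hmono.iterate k (hC k)).trans ih
  have htop : (C m).map A.subtype = A := by
    have : C m = ⊤ := by
      rw [eq_top_iff]
      intro a _ s hs
      rw [h hs, LinearMap.zero_apply]
    rw [this, ← MonoidHom.range_eq_map, Subgroup.range_subtype]
  have hbot : (C 0).map A.subtype ≤ ⁅A, A⁆ := by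
    rw [← map_commutator_subtype]
    refine Subgroup.map_mono fun a ha => ?_
    have h1 : Additive.ofMul (cls a) = 0 := ha 1 (by simp)
    rw [← Abelianization.ker_of, MonoidHom.mem_ker]
    exact h1
  have h1 := hiter m
  rw [htop] at h1
  exact h1.trans hbot

theorem exists_finiteIndex_iterate_commutator_le [Group.IsSolvable G] (A : Subgroup G) [A.Normal]
    (hA : A.FG) : ∃ H : Subgroup G, H.FiniteIndex ∧
      ∃ m, (fun X : Subgroup G => ⁅X, ⁅H, H⁆⁆)^[m] A ≤ ⁅A, A⁆ := by
  have : Group.FG A := (Group.fg_iff_subgroup_fg A).mpr hA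
  have : Group.FG (Abelianization A) := Group.fg_of_surjective
    (f := (Abelianization.of : A →* Abelianization A)) QuotientGroup.mk_surjective
  have : Module.Finite ℤ (Additive (Abelianization A)) :=
    Module.Finite.iff_addGroup_fg.mpr inferInstance
  obtain ⟨H, hH, m, hm⟩ := exists_finiteIndex_augSet_pow_of_int (abelianizationAction A)
  exact ⟨H, hH, m, iterate_commutator_le hm⟩

end Abelianization

/-! ### Polycyclic groups. -/

section Polycyclic

variable {G : Type*} [Group G]

/-- The image of C in the cyclic group A/B is cyclic, so C is generated by C ⊓ B and one lift c of a
generator. -/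
theorem Subgroup.fg_of_inf_fg_of_isCyclic {A B C : Subgroup G}
    [(B.subgroupOf A).Normal] [IsCyclic (A ⧸ B.subgroupOf A)] (hCA : C ≤ A)
    (hCB : (C ⊓ B).FG) : C.FG := by
  let f : C →* A ⧸ B.subgroupOf A := (QuotientGroup.mk' _).comp (Subgroup.inclusion hCA)
  obtain ⟨⟨_, c, rfl⟩, hc⟩ := IsCyclic.exists_generator (α := f.range)
  have : C = (C ⊓ B) ⊔ Subgroup.zpowers (c : G) := by
    refine le_antisymm (fun x hx => ?_) (sup_le inf_le_left (by simp))
    obtain ⟨n, hn⟩ := Subgroup.mem_zpowers_iff.mp (hc ⟨f ⟨x, hx⟩, ⟨x, hx⟩, rfl⟩)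
    have h1 : f (c ^ n) = f ⟨x, hx⟩ := by
      rw [map_zpow]
      exact congrArg Subtype.val hn
    have h2 : f (⟨x, hx⟩ * (c ^ n)⁻¹) = 1 := by rw [map_mul, map_inv, h1, mul_inv_cancel]
    have h3 : x * ((c : G) ^ n)⁻¹ ∈ B := by
      have h4 := (QuotientGroup.eq_one_iff _).mp h2
      simpa [Subgroup.mem_subgroupOf] using h4
    have h5 : x * ((c : G) ^ n)⁻¹ ∈ C := mul_mem hx (inv_mem (zpow_mem c.2 n))
    have h6 : x = (x * ((c : G) ^ n)⁻¹) * (c : G) ^ n := by group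
    rw [h6]
    exact Subgroup.mul_mem_sup ⟨h5, h3⟩ (Subgroup.zpow_mem_zpowers _ n)
  rw [this]
  refine hCB.sup ⟨{(c : G)}, ?_⟩
  simp [Subgroup.zpowers_eq_closure]

theorem IsPolycyclic.fg (h : IsPolycyclic G) (C : Subgroup G) : C.FG := by
  obtain ⟨r, s, h0, hr, hs⟩ := h
  have key : ∀ i ≤ r, ∀ C ≤ s i, C.FG := by
    intro i hi
    induction hi using Nat.decreasingInduction with
    | self =>
      intro C hC
      rw [hr, le_bot_iff] at hC
      rw [hC]
      exact ⟨∅, by simp⟩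
    | of_succ i hi ih =>
      intro C hC
      obtain ⟨-, hn, hc⟩ := hs i hi
      exact Subgroup.fg_of_inf_fg_of_isCyclic hC (ih _ inf_le_right)
  exact key 0 r.zero_le C (by rw [h0]; exact le_top)

theorem IsPolycyclic.isSolvable (h : IsPolycyclic G) : Group.IsSolvable G := by
  obtain ⟨r, s, h0, hr, hs⟩ := h
  have key : ∀ i ≤ r, Group.IsSolvable (s i) := by
    intro i hi
    induction hi using Nat.decreasingInduction with
    | self => rw [hr]; infer_instance
    | of_succ i hi ih =>
      obtain ⟨hle, hn, hc⟩ := hs i hi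
      have : Group.IsSolvable (s i ⧸ (s (i + 1)).subgroupOf (s i)) :=
        Group.isSolvable_of_comm fun a b => IsCyclic.commGroup.mul_comm a b
      refine Group.isSolvable_of_ker_le_range (Subgroup.inclusion hle)
        (QuotientGroup.mk' ((s (i + 1)).subgroupOf (s i))) ?_
      rw [QuotientGroup.ker_mk', Subgroup.inclusion_range]
  have h1 := key 0 r.zero_le
  rw [h0] at h1
  exact Group.isSolvable_of_isSolvable_injective (f := (Subgroup.topEquiv (G := G)).symm.toMonoidHom)
    (Subgroup.topEquiv (G := G)).symm.injective

theorem Subgroup.lowerCentralSeries_add (N : Subgroup G) (k n : ℕ) :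
    N.lowerCentralSeries (k + n) = (fun X : Subgroup G => ⁅X, N⁆)^[n] (N.lowerCentralSeries k) := by
  induction n with
  | zero => rfl
  | succ n ih => rw [Function.iterate_succ_apply', ← ih, ← add_assoc, lowerCentralSeries_succ]

theorem Subgroup.iterate_commutator_mono {X Y M N : Subgroup G} (hXY : X ≤ Y) (hMN : M ≤ N)
    (n : ℕ) : (fun X : Subgroup G => ⁅X, M⁆)^[n] X ≤ (fun X : Subgroup G => ⁅X, N⁆)^[n] Y := by
  induction n with
  | zero => exact hXY
  | succ n ih =>
    rw [Function.iterate_succ_apply', Function.iterate_succ_apply']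
    exact Subgroup.commutator_mono ih hMN

/-- Induction down the derived series: once the lower central series of H₁' has entered a term A, n
more commutators with (H₁ ⊓ H₂)' carry it into A'. Solubility ends this after finitely many
intersections. -/
theorem IsPolycyclic.hasPropertyR (h : IsPolycyclic G) : HasPropertyR G := by
  have hsol := h.isSolvable
  have key : ∀ i, ∃ H : Subgroup G, H.FiniteIndex ∧
      ∃ k, (⁅H, H⁆ : Subgroup G).lowerCentralSeries k ≤ derivedSeries G i := by
    intro i
    induction i with
    | zero => exact ⟨⊤, inferInstance, 0, le_top⟩
    | succ i ih =>
      obtain ⟨H₁, hH₁, k, hk⟩ := ih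
      obtain ⟨H₂, hH₂, n, hn⟩ :=
        exists_finiteIndex_iterate_commutator_le (derivedSeries G i) (h.fg _)
      refine ⟨H₁ ⊓ H₂, inferInstance, k + n, ?_⟩
      rw [Subgroup.lowerCentralSeries_add]
      refine (Subgroup.iterate_commutator_mono ?_
        (Subgroup.commutator_mono inf_le_right inf_le_right) n).trans hn
      exact (Subgroup.lowerCentralSeries_mono k
        (Subgroup.commutator_mono inf_le_left inf_le_left)).trans hk
  obtain ⟨d, hd⟩ := hsol.solvable
  obtain ⟨H, hH, k, hk⟩ := key d
  rw [hd, le_bot_iff] at hk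
  exact ⟨H, hH, isNilpotent_commutator_of_lowerCentralSeries hk⟩

end Polycyclic

theorem theorem9p5 :
    (∀ (K : Type*) [Field K] (V : Type*) [AddCommGroup V] [Module K V] [FiniteDimensional K V]
      (G : Subgroup (LinearMap.GeneralLinearGroup K V)), Group.IsSolvable G → HasPropertyR G) ∧
    (∀ (G : Type*) [Group G], IsPolycyclic G → HasPropertyR G) := by
  exact ⟨fun K _ V _ _ _ G _ => hasPropertyR_of_linear G, fun G _ h => h.hasPropertyR⟩
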